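/- For integers $s\ge 2$ and $p\ge 1$ let $\Theta^{(s,p)}$ be the generalized theta graph: two distinct endvertices $x,y$ connected by $p$ internally disjoint paths, each with $s$ edges. Let $\Theta^{(s,p)}+K_2$ denote its join with the complete graph on two vertices, i.e. the disjoint union of the two graphs together with all edges between them. For a finite simple graph $G$ let $P_G$ be its chromatic polynomial, i.e. the unique polynomial $P_G\in\mathbb C[q]$ whose value at each integer $k\ge 1$ is the number of proper colorings of $G$ with $k$ colors; a chromatic root of $G$ is a number $q\in\mathbb C$ with $P_G(q)=0$. **Corollary 1.3.** There is a countably infinite family of (not necessarily planar) pairwise non-isomorphic finite graphs whose chromatic roots, taken together, are dense in the whole complex plane. More precisely, the family consisting, up to isomorphism, of exactly the graphs $\Theta^{(s,p)}$ and $\Theta^{(s,p)}+K_2$ with $s\ge 2$, $p\ge 1$ is countably infinite, and the set of all chromatic roots of these graphs is dense in $\mathbb C$. -/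

import Mathlib

/-- The proper colorings of `G` with `k` colors correspond to pairs consisting of a partition of
the vertex set into independent classes and an injective assignment of colors to the classes. -/
theorem exists_polynomial_eval_eq_card_coloring {V : Type*} [Finite V] (G : SimpleGraph V) :
    ∃ P : Polynomial ℂ, ∀ k : ℕ, P.eval (k : ℂ) = (Nat.card (G.Coloring (Fin k)) : ℂ) := by
  classical
  have : Fintype V := Fintype.ofFinite V
  let I := {r : Setoid V // ∀ u v, G.Adj u v → ¬ r u v}
  have : Finite (Setoid V) :=
    Finite.of_injective (fun r : Setoid V => fun u v => r u v)
      (fun r₁ r₂ h => Setoid.ext fun u v => by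
        have := congrFun (congrFun h u) v
        exact iff_of_eq this)
  have : Finite I := Subtype.finite
  have : Fintype I := Fintype.ofFinite I
  have : ∀ r : I, Fintype (Quotient r.1) := fun r => Fintype.ofFinite _
  refine ⟨∑ r : I, descPochhammer ℂ (Fintype.card (Quotient r.1)), fun k => ?_⟩
  let e : G.Coloring (Fin k) ≃ Σ r : I, (Quotient r.1 ↪ Fin k) :=
    Equiv.ofBijective
      (fun c => ⟨⟨Setoid.ker c, fun u v h => c.valid h⟩,
        ⟨Quotient.lift c (fun _ _ h => h), by
          rintro ⟨a⟩ ⟨b⟩ h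
          exact Quotient.sound h⟩⟩) (by
      constructor
      · intro c d h
        have key : ∀ (x y : Σ r : I, (Quotient r.1 ↪ Fin k)), x = y →
            ∀ v : V, x.2 (Quotient.mk _ v) = y.2 (Quotient.mk _ v) := by
          rintro x _ rfl v; rfl
        ext v : 1
        exact key _ _ h v
      · rintro ⟨⟨r, hr⟩, f⟩
        have hker : Setoid.ker (fun v => f (Quotient.mk r v)) = r := by
          ext u v
          rw [Setoid.ker_def]
          exact ⟨fun h => Quotient.exact (f.injective h), fun h => congrArg f (Quotient.sound h)⟩
        refine ⟨SimpleGraph.Coloring.mk (fun v => f (Quotient.mk r v))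
          (fun {u v} h he => hr u v h (Quotient.exact (f.injective he))), ?_⟩
        have gen : ∀ (r' : Setoid V) (hr' : ∀ u v, G.Adj u v → ¬ r' u v)
            (f' : Quotient r' ↪ Fin k), r' = r →
            (∀ v, f' (Quotient.mk _ v) = f (Quotient.mk _ v)) →
            (⟨⟨r', hr'⟩, f'⟩ : Σ r : I, (Quotient r.1 ↪ Fin k)) = ⟨⟨r, hr⟩, f⟩ := by
          rintro r' hr' f' rfl h
          congr 1
          ext q : 1
          induction q using Quotient.inductionOn with
          | h v => exact h v
        exact gen _ _ _ hker (fun v => rfl))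
  rw [Nat.card_congr e, Nat.card_eq_fintype_card, Fintype.card_sigma, Polynomial.eval_finsetSum]
  push_cast
  refine Finset.sum_congr rfl fun r _ => ?_
  rw [descPochhammer_eval_eq_descFactorial, Fintype.card_embedding_eq, Fintype.card_fin]

/-- There is exactly one complex polynomial whose value at each positive integer `k` is the number
of proper colorings of the finite graph `G` with `k` colors. -/
theorem existsUnique_chromaticPolynomial {V : Type*} [Finite V] (G : SimpleGraph V) :
    ∃! P : Polynomial ℂ, ∀ k : ℕ, 1 ≤ k →
      P.eval (k : ℂ) = (Nat.card (G.Coloring (Fin k)) : ℂ) := by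
  obtain ⟨P, hP⟩ := exists_polynomial_eval_eq_card_coloring G
  refine ⟨P, fun k _ => hP k, fun Q hQ => ?_⟩
  refine Polynomial.eq_of_infinite_eval_eq Q P ?_
  refine ((Set.Ici_infinite (1 : ℕ)).image (Nat.cast_injective (R := ℂ)).injOn).mono ?_
  rintro _ ⟨k, hk, rfl⟩
  exact (hQ k hk).trans (hP k).symm

/-- The chromatic polynomial of a finite graph `G`, as a polynomial over `ℂ`: the unique polynomial
whose value at each integer `k ≥ 1` is the number of proper colorings of `G` with `k` colors. -/
noncomputable def chromaticPolynomial {V : Type*} [Finite V] (G : SimpleGraph V) : Polynomial ℂ :=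
  (existsUnique_chromaticPolynomial G).choose

theorem chromaticPolynomial_eval {V : Type*} [Finite V] (G : SimpleGraph V) (k : ℕ) (hk : 1 ≤ k) :
    (chromaticPolynomial G).eval (k : ℂ) = (Nat.card (G.Coloring (Fin k)) : ℂ) :=
  (existsUnique_chromaticPolynomial G).choose_spec.1 k hk

/-- The chromatic roots of a finite graph: the complex zeros of its chromatic polynomial. -/
def chromaticRoots {V : Type*} [Finite V] (G : SimpleGraph V) : Set ℂ :=
  {q : ℂ | (chromaticPolynomial G).IsRoot q}

/-- The vertices of the generalized theta graph made of `p` chains of `s` edges each: two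
endvertices `x = Sum.inl false` and `y = Sum.inl true`, and `s - 1` inner vertices on each of
the `p` chains. -/
abbrev ThetaVertex (s p : ℕ) : Type := Bool ⊕ (Fin p × Fin (s - 1))

/-- The vertex in position `j` (`0 ≤ j ≤ s`) on the `i`-th chain from `x` to `y`: it is `x` for
`j = 0`, the `j`-th inner vertex of the chain for `0 < j < s`, and `y` for `j = s`. -/
def thetaChain (s p : ℕ) (i : Fin p) (j : ℕ) : ThetaVertex s p :=
  if _h0 : j = 0 then Sum.inl false
  else if hs : j < s then Sum.inr (i, ⟨j - 1, by omega⟩)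
  else Sum.inl true

/-- The generalized theta graph `Θ^{(s,p)}`: endvertices `x`, `y` joined by `p` internally disjoint
paths of length `s`. Its edges join consecutive positions on the same chain. (For `s ≥ 2` the graph
obtained by connecting the chains in parallel has neither loops nor multiple edges.) -/
def thetaGraph (s p : ℕ) : SimpleGraph (ThetaVertex s p) :=
  SimpleGraph.fromRel fun u v =>
    ∃ i : Fin p, ∃ j : ℕ, j < s ∧ u = thetaChain s p i j ∧ v = thetaChain s p i (j + 1)

/-- The join of two graphs: their disjoint union, together with all edges between the two parts. -/
def graphJoin {V W : Type*} (G : SimpleGraph V) (H : SimpleGraph W) : SimpleGraph (V ⊕ W) :=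
  (G ⊕g H) ⊔ completeBipartiteGraph V W

/-- The join of the generalized theta graph `Θ^{(s,p)}` with the complete graph `K₂`. -/
def thetaJoinK2 (s p : ℕ) : SimpleGraph (ThetaVertex s p ⊕ Fin 2) :=
  graphJoin (thetaGraph s p) ((⊤ : SimpleGraph (Fin 2)))

/-! With `w = 1 - q`, counting colorings chain by chain shows that the chromatic roots `q ≠ 0` of
`Θ^{(s,p)}` are given by `(w ^ s - w) ^ p = w * (w ^ s - 1) ^ p`. As `p → ∞` the solutions
accumulate at the points of the curve `‖w ^ s - w‖ = ‖w ^ s - 1‖` outside the unit disk, and as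
`s → ∞` these curves come near every point there. Both limits are instances of one consequence of
Hurwitz's theorem: if `h` is not constant, `‖h z₀‖ = 1` and `K n` tends to a nonzero limit near
`z₀`, then `h z ^ n = K n z` has solutions near `z₀`. So the roots of theta graphs are dense outside
`‖q - 1‖ ≤ 1`. Joining with `K₂` translates chromatic roots by `2`, and the disk and its translate
meet only at `q = 2`. -/

open Filter Topology Metric Polynomial

/-! ### Colorings of theta graphs -/

section ThetaColorings

variable {α : Type*} {m p s : ℕ}

/-- The color in position `j` (`0 ≤ j ≤ m + 1`) of a chain with end colors `a`, `b` and inner colors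
`f`, with the indexing convention of `thetaChain`. -/
def chainColor (a b : α) (f : Fin m → α) (j : ℕ) : α :=
  if j = 0 then a else if h : j - 1 < m then f ⟨j - 1, h⟩ else b

/-- The proper colorings of the `m` inner vertices of a chain whose end colors are `a` and `b`. -/
abbrev ChainColoring (m : ℕ) (a b : α) : Type _ :=
  {f : Fin m → α // ∀ j < m + 1, chainColor a b f j ≠ chainColor a b f (j + 1)}

theorem chainColor_zero (a b : α) (f : Fin m → α) : chainColor a b f 0 = a := rfl

theorem chainColor_cons_succ (a b c : α) (f : Fin m → α) (j : ℕ) :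
    chainColor a b (Fin.cons c f : Fin (m + 1) → α) (j + 1) = chainColor c b f j := by
  cases j with
  | zero => rfl
  | succ j =>
    have hlt : j + 1 + 1 - 1 < m + 1 ↔ j + 1 - 1 < m := by omega
    simp only [chainColor, Nat.add_eq_zero_iff, one_ne_zero, and_false, if_false, hlt]
    rfl

theorem chainColor_cons_ne_succ_iff (a b c : α) (f : Fin m → α) :
    (∀ j < m + 2, chainColor a b (Fin.cons c f : Fin (m + 1) → α) j ≠
        chainColor a b (Fin.cons c f : Fin (m + 1) → α) (j + 1)) ↔
      c ≠ a ∧ ∀ j < m + 1, chainColor c b f j ≠ chainColor c b f (j + 1) := by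
  rw [Nat.forall_lt_succ_left]
  simp only [chainColor_cons_succ, chainColor_zero, ne_comm (a := a)]

/-- A coloring of a chain is the color of its first inner vertex, which differs from `a`, together
with a coloring of the shorter chain starting there. -/
def chainColoringSuccEquiv (m : ℕ) (a b : α) :
    ChainColoring (m + 1) a b ≃ Σ c : {c : α // c ≠ a}, ChainColoring m c.1 b where
  toFun f :=
    have h := (chainColor_cons_ne_succ_iff a b (f.1 0) (Fin.tail f.1)).1
      ((Fin.cons_self_tail f.1).symm ▸ f.2)
    ⟨⟨f.1 0, h.1⟩, ⟨Fin.tail f.1, h.2⟩⟩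
  invFun g := ⟨Fin.cons g.1.1 g.2.1, (chainColor_cons_ne_succ_iff ..).2 ⟨g.1.2, g.2.2⟩⟩
  left_inv f := Subtype.ext (Fin.cons_self_tail f.1)
  right_inv _ := rfl

theorem card_chainColoring_zero [DecidableEq α] (a b : α) :
    Nat.card (ChainColoring 0 a b) = if a = b then 0 else 1 := by
  have hproper (f : Fin 0 → α) :
      (∀ j < 0 + 1, chainColor a b f j ≠ chainColor a b f (j + 1)) ↔ a ≠ b := by
    simp [chainColor]
  rw [Nat.card_congr (Equiv.subtypeEquivRight hproper)]
  split_ifs with hab <;> simp [hab]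

theorem card_chainColoring_succ [Fintype α] [DecidableEq α] (m : ℕ) (a b : α) :
    Nat.card (ChainColoring (m + 1) a b) =
      ∑ c ∈ Finset.univ.erase a, Nat.card (ChainColoring m c b) := by
  rw [Nat.card_congr (chainColoringSuccEquiv m a b), Nat.card_sigma]
  exact (Finset.sum_subtype _ (by simp) fun c => Nat.card (ChainColoring m c b)).symm

theorem card_mul_card_chainColoring (R : Type*) [CommRing R] [Fintype α] [DecidableEq α]
    (m : ℕ) (a b : α) :
    (Fintype.card α : R) * (Nat.card (ChainColoring m a b) : R) =
      ((Fintype.card α : R) - 1) ^ (m + 1) +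
        ((if a = b then (Fintype.card α : R) else 0) - 1) * (-1) ^ (m + 1) := by
  induction m generalizing a with
  | zero =>
    rw [card_chainColoring_zero]
    split_ifs <;> push_cast <;> ring
  | succ m ih =>
    have hcard : ((Finset.univ.erase a).card : R) = Fintype.card α - 1 := by
      rw [Finset.card_erase_of_mem (Finset.mem_univ a), Finset.card_univ,
        Nat.cast_pred (Fintype.card_pos_iff.2 ⟨a⟩)]
    rw [card_chainColoring_succ, Nat.cast_sum, Finset.mul_sum, Finset.sum_congr rfl fun c _ => ih c,
      Finset.sum_add_distrib, ← Finset.sum_mul, Finset.sum_sub_distrib, Finset.sum_const,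
      Finset.sum_const, Finset.sum_ite_eq', nsmul_eq_mul, nsmul_eq_mul, hcard]
    by_cases hab : a = b
    · rw [if_neg (by simp [hab]), if_pos hab]
      ring
    · rw [if_pos (by simp [Ne.symm hab]), if_neg hab]
      ring

theorem thetaChain_ne_succ (i : Fin p) {j : ℕ} (hj : j < s) :
    thetaChain s p i j ≠ thetaChain s p i (j + 1) := by
  unfold thetaChain
  split_ifs <;> simp <;> omega

theorem thetaGraph_proper_iff (c : ThetaVertex s p → α) :
    (∀ u v, (thetaGraph s p).Adj u v → c u ≠ c v) ↔
      ∀ i, ∀ j < s, c (thetaChain s p i j) ≠ c (thetaChain s p i (j + 1)) := by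
  constructor
  · exact fun hc i j hj => hc _ _ ((SimpleGraph.fromRel_adj ..).2
      ⟨thetaChain_ne_succ i hj, Or.inl ⟨i, j, hj, rfl, rfl⟩⟩)
  · intro hc u v huv
    obtain ⟨-, ⟨i, j, hj, rfl, rfl⟩ | ⟨i, j, hj, rfl, rfl⟩⟩ := (SimpleGraph.fromRel_adj ..).1 huv
    · exact hc i j hj
    · exact (hc i j hj).symm

theorem apply_thetaChain_succ (c : ThetaVertex (m + 1) p → α) (i : Fin p) (j : ℕ) :
    c (thetaChain (m + 1) p i j) =
      chainColor (c (Sum.inl false)) (c (Sum.inl true)) (fun l => c (Sum.inr (i, l))) j := by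
  unfold thetaChain chainColor
  split_ifs <;> first | rfl | omega

/-- A coloring of `Θ^{(m+1,p)}` is a pair of colors of the endvertices together with a coloring of
each of the `p` chains. -/
def thetaGraphColoringEquiv (m p : ℕ) (α : Type*) :
    (thetaGraph (m + 1) p).Coloring α ≃ Σ e : α × α, (Fin p → ChainColoring m e.1 e.2) where
  toFun c := ⟨(c (Sum.inl false), c (Sum.inl true)), fun i => ⟨fun l => c (Sum.inr (i, l)),
    fun j hj => by
      have hc := (thetaGraph_proper_iff c).1 (fun _ _ => c.valid) i j hj
      rwa [apply_thetaChain_succ c, apply_thetaChain_succ c] at hc⟩⟩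
  invFun F := SimpleGraph.Coloring.mk
    (Sum.elim (fun t => bif t then F.1.2 else F.1.1) fun x => (F.2 x.1).1 x.2) <| by
      refine fun {u v} => (thetaGraph_proper_iff _).2 (fun i j hj => ?_) u v
      rw [apply_thetaChain_succ (Sum.elim _ _), apply_thetaChain_succ (Sum.elim _ _)]
      exact (F.2 i).2 j hj
  left_inv c := by
    ext v : 1
    rcases v with (_ | _) | _ <;> rfl
  right_inv _ := rfl

theorem sum_prod_ite_eq (R : Type*) [CommRing R] [Fintype α] [DecidableEq α] (x y : R) :
    ∑ e : α × α, (if e.1 = e.2 then x else y) =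
      Fintype.card α * x + Fintype.card α * (Fintype.card α - 1) * y := by
  have hsplit (e : α × α) : (if e.1 = e.2 then x else y) = y + if e.1 = e.2 then x - y else 0 := by
    split_ifs <;> ring
  simp only [hsplit, Finset.sum_add_distrib, Fintype.sum_prod_type, Finset.sum_ite_eq,
    Finset.mem_univ, if_true, Finset.sum_const, Finset.card_univ, Fintype.card_prod,
    Nat.cast_mul, nsmul_eq_mul]
  ring

theorem card_pow_mul_card_thetaGraph_coloring (R : Type*) [CommRing R] [Fintype α] (m p : ℕ) :
    (Fintype.card α : R) ^ p * (Nat.card ((thetaGraph (m + 1) p).Coloring α) : R) =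
      Fintype.card α * (((Fintype.card α : R) - 1) ^ (m + 1) +
          ((Fintype.card α : R) - 1) * (-1) ^ (m + 1)) ^ p +
        Fintype.card α * ((Fintype.card α : R) - 1) *
          (((Fintype.card α : R) - 1) ^ (m + 1) - (-1) ^ (m + 1)) ^ p := by
  classical
  rw [Nat.card_congr (thetaGraphColoringEquiv m p α), Nat.card_sigma, ← sum_prod_ite_eq,
    Nat.cast_sum, Finset.mul_sum]
  refine Finset.sum_congr rfl fun e _ => ?_
  rw [Nat.card_fun, Nat.card_fin, Nat.cast_pow, ← mul_pow, card_mul_card_chainColoring]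
  split_ifs <;> ring

end ThetaColorings

/-! ### Chromatic polynomials -/

theorem eq_of_eventually_eval_natCast_eq {R : Type*} [CommRing R] [IsDomain R] [CharZero R]
    {P Q : R[X]} (h : ∀ᶠ k : ℕ in atTop, P.eval (k : R) = Q.eval (k : R)) : P = Q :=
  eq_of_infinite_eval_eq P Q <|
    ((Nat.frequently_atTop_iff_infinite.1 h.frequently).image Nat.cast_injective.injOn).mono <|
      Set.image_subset_iff.2 fun _ hk => hk

section ChromaticRoots

variable {V W : Type*} [Finite V]

theorem chromaticRoots_congr [Finite W] {G : SimpleGraph V} {H : SimpleGraph W} (e : G ≃g H) :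
    chromaticRoots G = chromaticRoots H := by
  have hP : chromaticPolynomial G = chromaticPolynomial H := by
    refine eq_of_eventually_eval_natCast_eq ((eventually_ge_atTop 1).mono fun k hk => ?_)
    rw [chromaticPolynomial_eval G k hk, chromaticPolynomial_eval H k hk,
      Nat.card_congr (SimpleGraph.coloringCongr e (Equiv.refl _))]
  rw [chromaticRoots, chromaticRoots, hP]

theorem chromaticPolynomial_thetaGraph_eval {s : ℕ} (hs : s ≠ 0) (p : ℕ) (q : ℂ) :
    q ^ p * (chromaticPolynomial (thetaGraph s p)).eval q =
      q * ((q - 1) ^ s + (q - 1) * (-1) ^ s) ^ p + q * (q - 1) * ((q - 1) ^ s - (-1) ^ s) ^ p := by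
  obtain ⟨m, rfl⟩ := Nat.exists_eq_succ_of_ne_zero hs
  have hP : X ^ p * chromaticPolynomial (thetaGraph (m + 1) p) =
      X * ((X - 1) ^ (m + 1) + (X - 1) * (-1) ^ (m + 1)) ^ p +
        X * (X - 1) * ((X - 1) ^ (m + 1) - (-1) ^ (m + 1)) ^ p := by
    refine eq_of_eventually_eval_natCast_eq ((eventually_ge_atTop 1).mono fun k hk => ?_)
    simpa [chromaticPolynomial_eval _ k hk] using
      card_pow_mul_card_thetaGraph_coloring (α := Fin k) ℂ m p
  simpa using congrArg (eval q) hP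

theorem one_sub_mem_chromaticRoots_thetaGraph_iff {s : ℕ} (hs : s ≠ 0) (p : ℕ) {w : ℂ}
    (hw : w ≠ 1) :
    1 - w ∈ chromaticRoots (thetaGraph s p) ↔ (w ^ s - w) ^ p = w * (w ^ s - 1) ^ p := by
  have hw' : 1 - w ≠ 0 := sub_ne_zero.2 hw.symm
  have hsign : ((-1 : ℂ) ^ s) ^ p ≠ 0 := by simp
  have hP : (1 - w) ^ p * (chromaticPolynomial (thetaGraph s p)).eval (1 - w) =
      ((-1) ^ s) ^ p * (1 - w) * ((w ^ s - w) ^ p - w * (w ^ s - 1) ^ p) := by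
    rw [chromaticPolynomial_thetaGraph_eval hs, show 1 - w - 1 = -1 * w by ring, mul_pow (-1) w,
      show (-1) ^ s * w ^ s + -1 * w * (-1) ^ s = (-1) ^ s * (w ^ s - w) by ring,
      show (-1) ^ s * w ^ s - (-1) ^ s = (-1) ^ s * (w ^ s - 1) by ring, mul_pow, mul_pow]
    ring
  rw [← sub_eq_zero, ← mul_eq_zero_iff_left (mul_ne_zero hsign hw'), ← hP,
    mul_eq_zero_iff_left (pow_ne_zero p hw')]
  rfl

/-- A coloring of the join of `G` with a complete graph colors the complete graph injectively, and
`G` with the remaining colors. -/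
def graphJoinTopColoringEquiv {V W : Type*} (G : SimpleGraph V) (α : Type*) :
    (graphJoin G (⊤ : SimpleGraph W)).Coloring α ≃
      Σ e : W ↪ α, G.Coloring {c : α // c ∉ Set.range e} where
  toFun c := ⟨⟨fun i => c (Sum.inr i), fun i j h => by
      by_contra hij
      exact c.valid (v := Sum.inr i) (w := Sum.inr j) (by simpa [graphJoin] using hij) h⟩,
    SimpleGraph.Coloring.mk (fun v => ⟨c (Sum.inl v), by
      rintro ⟨i, hi⟩
      exact c.valid (v := Sum.inr i) (w := Sum.inl v) (by simp [graphJoin]) hi⟩)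
      (fun {u v} h he => c.valid (v := Sum.inl u) (w := Sum.inl v) (by simpa [graphJoin] using h)
        (congrArg Subtype.val he))⟩
  invFun F := SimpleGraph.Coloring.mk (Sum.elim (fun v => (F.2 v).1) F.1) <| by
    rintro (u | i) (v | j) h
    · exact fun he => F.2.valid (by simpa [graphJoin] using h) (Subtype.ext he)
    · exact fun he => (F.2 u).2 ⟨j, he.symm⟩
    · exact fun he => (F.2 v).2 ⟨i, he⟩
    · exact fun he => absurd (F.1.injective he) (by simpa [graphJoin] using h)
  left_inv c := by
    ext v : 1
    rcases v with _ | _ <;> rfl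
  right_inv _ := rfl

variable [Fintype W]

theorem card_graphJoin_top_coloring (G : SimpleGraph V) (k : ℕ) :
    Nat.card ((graphJoin G (⊤ : SimpleGraph W)).Coloring (Fin (k + Fintype.card W))) =
      (k + Fintype.card W).descFactorial (Fintype.card W) * Nat.card (G.Coloring (Fin k)) := by
  classical
  have (β : Type) [Finite β] : Finite (G.Coloring β) := DFunLike.finite _
  have hcompl (e : W ↪ Fin (k + Fintype.card W)) :
      Nat.card (G.Coloring {c // c ∉ Set.range e}) = Nat.card (G.Coloring (Fin k)) := by
    refine Nat.card_congr (G.recolorOfEquiv (Fintype.equivFinOfCardEq ?_))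
    rw [Fintype.card_subtype_compl, Fintype.card_fin, Set.card_range_of_injective e.injective,
      Nat.add_sub_cancel]
  rw [Nat.card_congr (graphJoinTopColoringEquiv G _), Nat.card_sigma,
    Finset.sum_congr rfl fun e _ => hcompl e, Finset.sum_const, Finset.card_univ,
    Fintype.card_embedding_eq, Fintype.card_fin, smul_eq_mul]

theorem chromaticPolynomial_graphJoin_top_comp (G : SimpleGraph V) :
    (chromaticPolynomial (graphJoin G (⊤ : SimpleGraph W))).comp (X + (Fintype.card W : ℂ[X])) =
      (descPochhammer ℂ (Fintype.card W)).comp (X + (Fintype.card W : ℂ[X])) *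
        chromaticPolynomial G := by
  refine eq_of_eventually_eval_natCast_eq ((eventually_ge_atTop 1).mono fun k hk => ?_)
  rw [eval_mul, eval_comp, eval_comp, eval_add, eval_X, eval_natCast, ← Nat.cast_add,
    chromaticPolynomial_eval _ _ (le_add_right hk), card_graphJoin_top_coloring,
    descPochhammer_eval_eq_descFactorial, chromaticPolynomial_eval G k hk, Nat.cast_mul]

theorem add_card_mem_chromaticRoots_graphJoin_top (G : SimpleGraph V) {q : ℂ}
    (hq : q ∈ chromaticRoots G) :
    q + Fintype.card W ∈ chromaticRoots (graphJoin G (⊤ : SimpleGraph W)) := by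
  have hq' : (chromaticPolynomial G).eval q = 0 := hq
  change eval (q + Fintype.card W) _ = 0
  simpa [hq'] using congrArg (eval q) (chromaticPolynomial_graphJoin_top_comp (W := W) G)

end ChromaticRoots

/-! ### Solutions of `h z ^ n = K n z` near a point where `‖h z‖ = 1` -/

theorem hurwitz_eventually_exists_zero_of_tendstoUniformlyOn {ι : Type*} {l : Filter ι} [l.NeBot]
    {F : ι → ℂ → ℂ} {g : ℂ → ℂ} {U : Set ℂ} {z₀ : ℂ} (hU : U ∈ 𝓝 z₀)
    (hF : ∀ᶠ n in l, DifferentiableOn ℂ (F n) U) (hlim : TendstoUniformlyOn F g l U)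
    (hg₀ : g z₀ = 0) (hg : ∀ᶠ z in 𝓝[≠] z₀, g z ≠ 0) : ∀ᶠ n in l, ∃ z ∈ U, F n z = 0 := by
  have hgc : ContinuousOn g U := hlim.continuousOn (hF.mono fun n h => h.continuousOn).frequently
  obtain ⟨δ, hδ, hball⟩ : ∃ δ > 0, closedBall z₀ δ ⊆ U ∩ {z | z ≠ z₀ → g z ≠ 0} :=
    nhds_basis_closedBall.mem_iff.1 (inter_mem hU (eventually_nhdsWithin_iff.1 hg))
  have hballU : closedBall z₀ δ ⊆ U := hball.trans Set.inter_subset_left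
  obtain ⟨ξ, hξ, hmin⟩ : ∃ ξ ∈ sphere z₀ δ, IsMinOn (fun z => ‖g z‖) (sphere z₀ δ) ξ :=
    (isCompact_sphere z₀ δ).exists_isMinOn (NormedSpace.sphere_nonempty.2 hδ.le)
      (hgc.norm.mono (sphere_subset_closedBall.trans hballU))
  have hη : 0 < ‖g ξ‖ / 2 :=
    half_pos (norm_pos_iff.2 ((hball (sphere_subset_closedBall hξ)).2 (ne_of_mem_sphere hξ hδ.ne')))
  filter_upwards [hF, Metric.tendstoUniformlyOn_iff.1 hlim _ hη] with n hFn hnear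
  -- A zero-free `F n` would contradict the maximum principle for `(F n)⁻¹` on the ball.
  by_contra! hne
  have hinv : DiffContOnCl ℂ (F n)⁻¹ (ball z₀ δ) :=
    (hFn.mono hballU).diffContOnCl_ball subset_rfl |>.inv fun z hz =>
      hne z (hballU (closure_ball_subset_closedBall hz))
  have hsphere : ∀ z ∈ frontier (ball z₀ δ), ‖(F n)⁻¹ z‖ ≤ (‖g ξ‖ / 2)⁻¹ := fun z hz => by
    have hz : z ∈ sphere z₀ δ := frontier_ball_subset_sphere hz
    have hdist := hnear z (hballU (sphere_subset_closedBall hz))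
    rw [dist_eq_norm] at hdist
    rw [Pi.inv_apply, norm_inv]
    refine inv_anti₀ hη ?_
    linarith [norm_sub_norm_le (g z) (F n z), show ‖g ξ‖ ≤ ‖g z‖ from hmin hz]
  have hcenter : ‖(F n)⁻¹ z₀‖ ≤ (‖g ξ‖ / 2)⁻¹ :=
    Complex.norm_le_of_forall_mem_frontier_norm_le isBounded_ball hinv hsphere
      (subset_closure (mem_ball_self hδ))
  have hz₀ : ‖F n z₀‖ < ‖g ξ‖ / 2 := by
    simpa [hg₀] using hnear z₀ (mem_of_mem_nhds hU)
  rw [Pi.inv_apply, norm_inv] at hcenter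
  exact (inv_strictAnti₀ (norm_pos_iff.2 (hne z₀ (mem_of_mem_nhds hU))) hz₀).not_ge hcenter

theorem norm_clog_le (z : ℂ) : ‖Complex.log z‖ ≤ |Real.log ‖z‖| + Real.pi :=
  (Complex.norm_le_abs_re_add_abs_im _).trans <| by
    rw [Complex.log_re, Complex.log_im]
    exact add_le_add_right (Complex.abs_arg_le_pi z) _

theorem pow_eq_of_mul_log_div_eq {x y u a : ℂ} {n : ℕ} (hx : x ≠ 0) (hy : y ≠ 0) (hu : u ≠ 0)
    (ha : a ≠ 0)
    (h : n * Complex.log (x / u) = Complex.log (y / a) + Complex.log (a / u ^ n)) :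
    x ^ n = y := by
  have hexp := congrArg Complex.exp h
  rw [Complex.exp_nat_mul, Complex.exp_add, Complex.exp_log (div_ne_zero hx hu),
    Complex.exp_log (div_ne_zero hy ha), Complex.exp_log (div_ne_zero ha (pow_ne_zero n hu)),
    div_mul_div_cancel₀ ha, div_pow] at hexp
  exact (div_left_inj' (pow_ne_zero n hu)).1 hexp

section PowEq

variable {h : ℂ → ℂ} {K : ℕ → ℂ → ℂ} {z₀ a : ℂ}

theorem eventually_log_div_ne_zero (hh : AnalyticAt ℂ h z₀) (hz₀ : h z₀ ≠ 0)
    (hconst : ∃ᶠ z in 𝓝 z₀, h z ≠ h z₀) :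
    ∀ᶠ z in 𝓝[≠] z₀, Complex.log (h z / h z₀) ≠ 0 := by
  have hne : ∀ᶠ z in 𝓝[≠] z₀, h z ≠ h z₀ :=
    (hh.eventually_eq_or_eventually_ne analyticAt_const).resolve_left fun hev =>
      hconst (hev.mono fun _ => not_not.2)
  filter_upwards [hne, (hh.continuousAt.eventually_ne hz₀).filter_mono nhdsWithin_le_nhds]
    with z hz hz' hlog
  refine hz ((div_eq_one_iff_eq hz₀).1 ?_)
  rw [← Complex.exp_log (div_ne_zero hz' hz₀), hlog, Complex.exp_zero]

theorem tendstoUniformlyOn_sub_div_natCast {X : Type*} {g : X → ℂ} {L : ℕ → X → ℂ} {S : Set X}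
    {C : ℝ} (hL : ∀ᶠ n in atTop, ∀ x ∈ S, ‖L n x‖ ≤ C) :
    TendstoUniformlyOn (fun n x => g x - L n x / n) g atTop S := by
  refine Metric.tendstoUniformlyOn_iff.2 fun ε hε => ?_
  filter_upwards [hL, (tendsto_const_div_atTop_nhds_zero_nat C).eventually_lt_const hε]
    with n hn hC x hx
  rw [dist_eq_norm, sub_sub_cancel, norm_div, Complex.norm_natCast]
  exact (div_le_div_of_nonneg_right (hn x hx) n.cast_nonneg).trans_lt hC

theorem eventually_exists_pow_eq {U : Set ℂ} (hU : U ∈ 𝓝 z₀) (hh : AnalyticAt ℂ h z₀)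
    (hnorm : ‖h z₀‖ = 1) (hconst : ∃ᶠ z in 𝓝 z₀, h z ≠ h z₀)
    (hK : ∀ᶠ x : ℕ × ℂ in atTop ×ˢ 𝓝 z₀, DifferentiableAt ℂ (K x.1) x.2)
    (hlim : Tendsto (fun x : ℕ × ℂ => K x.1 x.2) (atTop ×ˢ 𝓝 z₀) (𝓝 a)) (ha : a ≠ 0) :
    ∀ᶠ n in atTop, ∃ z ∈ U, h z ^ n = K n z := by
  have hz₀ : h z₀ ≠ 0 := norm_ne_zero_iff.1 (hnorm ▸ one_ne_zero)
  have hh_slit : ∀ᶠ z in 𝓝 z₀, h z / h z₀ ∈ Complex.slitPlane :=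
    (hh.continuousAt.div_const _).eventually_mem
      (Complex.isOpen_slitPlane.mem_nhds (by simp [div_self hz₀]))
  have hlim_div : Tendsto (fun x : ℕ × ℂ => K x.1 x.2 / a) (atTop ×ˢ 𝓝 z₀) (𝓝 1) := by
    simpa [ha] using hlim.div_const a
  have hK_slit : ∀ᶠ x : ℕ × ℂ in atTop ×ˢ 𝓝 z₀, K x.1 x.2 / a ∈ Complex.slitPlane :=
    hlim_div.eventually_mem (Complex.isOpen_slitPlane.mem_nhds (by simp))
  have hK_log : ∀ᶠ x : ℕ × ℂ in atTop ×ˢ 𝓝 z₀, ‖Complex.log (K x.1 x.2 / a)‖ < 1 :=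
    (hlim_div.clog (by simp)).norm.eventually_lt_const (by simp)
  obtain ⟨large, hlarge, near, hnear, hgood⟩ := eventually_prod_iff.1 <|
    (((eventually_mem_set.2 hU).and (hh.eventually_analyticAt.and hh_slit)).prod_inr atTop).and <|
      hK.and <| hK_slit.and hK_log
  let g : ℂ → ℂ := fun z => Complex.log (h z / h z₀)
  let L : ℕ → ℂ → ℂ := fun n z => Complex.log (K n z / a) + Complex.log (a / h z₀ ^ n)
  have hL_bound : ∀ᶠ n in atTop, ∀ z ∈ {z | near z}, ‖L n z‖ ≤ 1 + (|Real.log ‖a‖| + Real.pi) := by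
    filter_upwards [hlarge] with n hn z hz
    obtain ⟨-, -, -, hlog⟩ := hgood hn hz
    refine (norm_add_le _ _).trans (add_le_add hlog.le ?_)
    simpa [hnorm] using norm_clog_le (a / h z₀ ^ n)
  have hdiff : ∀ᶠ n in atTop, DifferentiableOn ℂ (fun z => g z - L n z / n) {z | near z} := by
    filter_upwards [hlarge] with n hn z hz
    obtain ⟨⟨-, hhz, hhs⟩, hKz, hKs, -⟩ := hgood hn hz
    exact (((hhz.differentiableAt.div_const _).clog hhs).sub
      ((((hKz.div_const a).clog hKs).add_const _).div_const _)).differentiableWithinAt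
  -- A zero of `g - L n / n` satisfies the logarithm of the equation `h z ^ n = K n z`.
  filter_upwards [hlarge, eventually_ne_atTop 0,
    hurwitz_eventually_exists_zero_of_tendstoUniformlyOn hnear hdiff
      (tendstoUniformlyOn_sub_div_natCast hL_bound) (by simp [g])
      (eventually_log_div_ne_zero hh hz₀ hconst)] with n hn hn₀ ⟨z, hz, hzero⟩
  obtain ⟨⟨hzU, -, hhs⟩, -, hKs, -⟩ := hgood hn hz
  have hgL : n * g z = L n z := by
    rw [sub_eq_zero.1 hzero, mul_div_cancel₀ _ (Nat.cast_ne_zero.2 hn₀)]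
  exact ⟨z, hzU, pow_eq_of_mul_log_div_eq (div_ne_zero_iff.1 (Complex.slitPlane_ne_zero hhs)).1
    (div_ne_zero_iff.1 (Complex.slitPlane_ne_zero hKs)).1 hz₀ ha hgL⟩

end PowEq

/-! ### Density of the roots -/

theorem norm_perpBisector_sub_right_eq_left (a b : ℂ) (x : ℝ) :
    ‖x * Complex.I * (b - a) + (a + b) / 2 - b‖ = ‖x * Complex.I * (b - a) + (a + b) / 2 - a‖ := by
  have hconj : ‖(x : ℂ) * Complex.I - 1 / 2‖ = ‖(x : ℂ) * Complex.I + 1 / 2‖ := by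
    rw [← norm_neg, ← Complex.norm_conj]
    congr 1
    simp [add_comm, map_ofNat]
  rw [show x * Complex.I * (b - a) + (a + b) / 2 - b = (b - a) * (x * Complex.I - 1 / 2) by ring,
    show x * Complex.I * (b - a) + (a + b) / 2 - a = (b - a) * (x * Complex.I + 1 / 2) by ring,
    norm_mul, norm_mul, hconj]

theorem eventually_exists_norm_pow_sub_self_eq {w₀ : ℂ} (hw₀ : 1 < ‖w₀‖) {U : Set ℂ}
    (hU : U ∈ 𝓝 w₀) : ∀ᶠ s : ℕ in atTop, ∃ w ∈ U, ‖w ^ s - w‖ = ‖w ^ s - 1‖ := by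
  -- It suffices that `w ^ s = r ^ s * I * (w - 1) + (1 + w) / 2`, which is on the perpendicular
  -- bisector of `1` and `w`.
  set r : ℝ := ‖w₀‖
  have hr₀ : (r : ℂ) ≠ 0 := Complex.ofReal_ne_zero.2 (zero_lt_one.trans hw₀).ne'
  have hr_norm : ‖(r : ℂ)‖ = r := Complex.norm_of_nonneg (norm_nonneg w₀)
  have hw₀_ne : w₀ ≠ 1 := fun h => hw₀.ne' (by simp [r, h])
  have hnorm : ‖w₀ / r‖ = 1 := by
    rw [norm_div, hr_norm, div_self (zero_lt_one.trans hw₀).ne']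
  have hconst : ∃ᶠ w in 𝓝 w₀, w / r ≠ w₀ / r :=
    ((eventually_mem_nhdsWithin (s := {w₀}ᶜ)).frequently.filter_mono nhdsWithin_le_nhds).mono
      fun _ => (div_left_inj' hr₀).not.2
  have hlim : Tendsto (fun x : ℕ × ℂ => Complex.I * (x.2 - 1) + (1 + x.2) / 2 * (r : ℂ)⁻¹ ^ x.1)
      (atTop ×ˢ 𝓝 w₀) (𝓝 (Complex.I * (w₀ - 1))) := by
    have hpow : Tendsto (fun s : ℕ => (r : ℂ)⁻¹ ^ s) atTop (𝓝 0) :=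
      tendsto_pow_atTop_nhds_zero_of_norm_lt_one <| by
        rw [norm_inv, hr_norm]
        exact inv_lt_one_of_one_lt₀ hw₀
    have hid : Tendsto Prod.snd (atTop ×ˢ 𝓝 w₀ : Filter (ℕ × ℂ)) (𝓝 w₀) := tendsto_snd
    simpa using ((hid.sub_const 1).const_mul Complex.I).add
      (((hid.const_add 1).div_const 2).mul (hpow.comp tendsto_fst))
  filter_upwards [eventually_exists_pow_eq (h := fun w => w / r)
    (K := fun s w => Complex.I * (w - 1) + (1 + w) / 2 * (r : ℂ)⁻¹ ^ s) hU
    (by fun_prop (disch := assumption)) hnorm hconst (.of_forall fun x => by fun_prop) hlim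
    (mul_ne_zero Complex.I_ne_zero (sub_ne_zero.2 hw₀_ne))] with s ⟨w, hwU, hw⟩
  have hpow : w ^ s = (r ^ s : ℝ) * Complex.I * (w - 1) + (1 + w) / 2 := by
    rw [div_pow, div_eq_iff (pow_ne_zero s hr₀), inv_pow] at hw
    rw [hw, Complex.ofReal_pow]
    field_simp
  exact ⟨w, hwU, by rw [hpow, norm_perpBisector_sub_right_eq_left]⟩

theorem eventually_exists_pow_sub_self_pow_eq {s : ℕ} {w₁ : ℂ} (hw₁ : w₁ ≠ 0) (hpow : w₁ ^ s ≠ 1)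
    (hcurve : ‖w₁ ^ s - w₁‖ = ‖w₁ ^ s - 1‖) {U : Set ℂ} (hU : U ∈ 𝓝 w₁) :
    ∀ᶠ p : ℕ in atTop, ∃ w ∈ U, (w ^ s - w) ^ p = w * (w ^ s - 1) ^ p := by
  have hs : s ≠ 0 := by rintro rfl; simp at hpow
  have hden : w₁ ^ s - 1 ≠ 0 := sub_ne_zero.2 hpow
  have hden_near : ∀ᶠ w in 𝓝 w₁, w ^ s - 1 ≠ 0 :=
    ContinuousAt.eventually_ne (g := fun w : ℂ => w ^ s - 1) (by fun_prop) hden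
  let h : ℂ → ℂ := fun w => (w ^ s - w) / (w ^ s - 1)
  have hnorm : ‖h w₁‖ = 1 := by
    rw [norm_div, hcurve, div_self (norm_ne_zero_iff.2 hden)]
  have hconst : ∃ᶠ w in 𝓝 w₁, h w ≠ h w₁ := by
    intro hev
    have hid : (fun w : ℂ => w ^ s - w) = fun w => h w₁ * (w ^ s - 1) := by
      refine AnalyticOnNhd.eq_of_eventuallyEq (𝕜 := ℂ) (z₀ := w₁) (fun w _ => by fun_prop)
        (fun w _ => by fun_prop) ?_
      filter_upwards [hev, hden_near] with w hw hw'
      exact (div_eq_iff hw').1 (not_not.1 hw)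
    have hzero : h w₁ = 0 := by simpa [hs] using congrFun hid 0
    simp [hzero] at hnorm
  filter_upwards [eventually_exists_pow_eq (K := fun _ w => w) (inter_mem hU hden_near)
    (by fun_prop (disch := assumption)) hnorm hconst (.of_forall fun _ => by fun_prop) tendsto_snd
    hw₁] with p ⟨w, ⟨hwU, hw'⟩, hw⟩
  exact ⟨w, hwU, (div_eq_iff (pow_ne_zero p hw')).1 (by rwa [← div_pow])⟩

theorem exists_pow_sub_self_pow_eq {w₀ : ℂ} (hw₀ : 1 < ‖w₀‖) {U : Set ℂ} (hU : U ∈ 𝓝 w₀) :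
    ∃ s p : ℕ, 2 ≤ s ∧ 1 ≤ p ∧ ∃ w ∈ U, (w ^ s - w) ^ p = w * (w ^ s - 1) ^ p := by
  have hnear : ∀ᶠ w in 𝓝 w₀, U ∈ 𝓝 w ∧ 1 < ‖w‖ :=
    (eventually_mem_nhds_iff.2 hU).and (continuous_norm.continuousAt.eventually_const_lt hw₀)
  obtain ⟨s, ⟨w₁, ⟨hU₁, hw₁⟩, hcurve⟩, hs⟩ :=
    ((eventually_exists_norm_pow_sub_self_eq hw₀ hnear).and (eventually_ge_atTop 2)).exists
  have hw₁_zero : w₁ ≠ 0 := norm_pos_iff.1 (zero_lt_one.trans hw₁)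
  have hw₁_pow : w₁ ^ s ≠ 1 := fun h =>
    (one_lt_pow₀ hw₁ (by omega : s ≠ 0)).ne' (by rw [← norm_pow, h, norm_one])
  obtain ⟨p, hw, hp⟩ := ((eventually_exists_pow_sub_self_pow_eq hw₁_zero hw₁_pow hcurve hU₁).and
    (eventually_ge_atTop 1)).exists
  exact ⟨s, p, hs, hp, hw⟩

theorem mem_closure_chromaticRoots_thetaGraph {q : ℂ} (hq : 1 < ‖q - 1‖) :
    q ∈ closure {z | ∃ s p : ℕ, 2 ≤ s ∧ 1 ≤ p ∧ z ∈ chromaticRoots (thetaGraph s p)} := by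
  refine mem_closure_iff_nhds.2 fun U hU => ?_
  have hU' : ∀ᶠ w in 𝓝 (1 - q), 1 - w ∈ U ∧ w ≠ 1 := by
    refine Eventually.and ?_ (eventually_ne_nhds ?_)
    · exact ContinuousAt.eventually_mem (f := fun w : ℂ => 1 - w) (by fun_prop) (by simpa using hU)
    · rintro h
      norm_num [show q = 0 by simpa using h] at hq
  obtain ⟨s, p, hs, hp, w, ⟨hwU, hw₁⟩, hw⟩ :=
    exists_pow_sub_self_pow_eq (by rwa [norm_sub_rev]) hU'
  exact ⟨1 - w, hwU, s, p, hs, hp,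
    (one_sub_mem_chromaticRoots_thetaGraph_iff (by omega) p hw₁).2 hw⟩

theorem eq_two_of_norm_sub_one_le {q : ℂ} (h₁ : ‖q - 1‖ ≤ 1) (h₂ : ‖q - 2 - 1‖ ≤ 1) : q = 2 := by
  have hpar := parallelogram_law_with_norm ℝ (q - 2) 1
  rw [show q - 2 + 1 = q - 1 by ring, norm_one] at hpar
  have hnorm : ‖q - 2‖ = 0 := by nlinarith [norm_nonneg (q - 1), norm_nonneg (q - 2 - 1)]
  exact sub_eq_zero.1 (norm_eq_zero.1 hnorm)

theorem dense_of_chromaticRoots_theta_subset {R : Set ℂ}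
    (hθ : ∀ s p : ℕ, 2 ≤ s → 1 ≤ p → chromaticRoots (thetaGraph s p) ⊆ R)
    (hJ : ∀ s p : ℕ, 2 ≤ s → 1 ≤ p → chromaticRoots (thetaJoinK2 s p) ⊆ R) : Dense R := by
  rw [← dense_closure]
  refine (dense_compl_singleton (2 : ℂ)).mono fun q hq => ?_
  by_cases h₁ : ‖q - 1‖ ≤ 1
  · have h₂ : 1 < ‖q - 2 - 1‖ := not_le.1 fun h₂ => hq (eq_two_of_norm_sub_one_le h₁ h₂)
    have hmaps : Set.MapsTo (· + 2)
        {z | ∃ s p : ℕ, 2 ≤ s ∧ 1 ≤ p ∧ z ∈ chromaticRoots (thetaGraph s p)} R := by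
      rintro z ⟨s, p, hs, hp, hz⟩
      refine hJ s p hs hp ?_
      simpa [thetaJoinK2] using
        add_card_mem_chromaticRoots_graphJoin_top (W := Fin 2) (thetaGraph s p) hz
    simpa using map_mem_closure (continuous_add_const 2)
      (mem_closure_chromaticRoots_thetaGraph h₂) hmaps
  · refine closure_mono ?_ (mem_closure_chromaticRoots_thetaGraph (not_le.1 h₁))
    rintro z ⟨s, p, hs, hp, hz⟩
    exact hθ s p hs hp hz

/-! ### Enumeration of the isomorphism classes -/

theorem exists_seq_of_infinite_image_mk {α : Type*} [Countable α] (r : Setoid α) {S : Set α}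
    (hS : (Quotient.mk r '' S).Infinite) :
    ∃ x : ℕ → α, (∀ i, x i ∈ S) ∧ (∀ i j, i ≠ j → ¬ r (x i) (x j)) ∧ ∀ a ∈ S, ∃ i, r (x i) a := by
  have := hS.to_subtype
  obtain ⟨e⟩ : Nonempty (ℕ ≃ Quotient.mk r '' S) := nonempty_equiv_of_countable
  choose x hxS hx using fun i => (e i).2
  refine ⟨x, hxS, fun i j hij hr => hij (e.injective (Subtype.ext ?_)), fun a ha => ?_⟩
  · rw [← hx i, ← hx j]
    exact Quotient.sound hr
  · refine ⟨e.symm ⟨_, a, ha, rfl⟩, Quotient.exact ?_⟩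
    rw [hx, e.apply_symm_apply]

/-- Isomorphism of graphs on the vertex sets `Fin n`. -/
def finGraphSetoid : Setoid (Σ n : ℕ, SimpleGraph (Fin n)) where
  r G H := Nonempty (G.2 ≃g H.2)
  iseqv := ⟨fun _ => ⟨SimpleGraph.Iso.refl⟩, fun ⟨e⟩ => ⟨e.symm⟩, fun ⟨e⟩ ⟨f⟩ => ⟨f.comp e⟩⟩

/-- The graphs on the vertex sets `Fin n` that are isomorphic to some `Θ^{(s,p)}` or
`Θ^{(s,p)} + K₂` with `s ≥ 2` and `p ≥ 1`. -/
def thetaFamily : Set (Σ n : ℕ, SimpleGraph (Fin n)) :=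
  {G | ∃ s p : ℕ, 2 ≤ s ∧ 1 ≤ p ∧
    (Nonempty (G.2 ≃g thetaGraph s p) ∨ Nonempty (G.2 ≃g thetaJoinK2 s p))}

theorem exists_finGraph_iso {V : Type*} [Finite V] (G : SimpleGraph V) :
    ∃ H : Σ n : ℕ, SimpleGraph (Fin n), Nonempty (H.2 ≃g G) :=
  have := Fintype.ofFinite V
  ⟨⟨_, G.overFin rfl⟩, ⟨(G.overFinIso rfl).symm⟩⟩

theorem infinite_image_mk_thetaFamily : (Quotient.mk finGraphSetoid '' thetaFamily).Infinite := by
  choose H hH using fun p => exists_finGraph_iso (thetaGraph 2 (p + 1))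
  refine Set.infinite_of_injective_forall_mem (f := fun p => Quotient.mk finGraphSetoid (H p)) ?_
    fun p => ⟨H p, ⟨2, p + 1, le_rfl, by omega, Or.inl (hH p)⟩, rfl⟩
  intro p p' hpp'
  obtain ⟨e⟩ : Nonempty ((H p).2 ≃g (H p').2) := Quotient.exact hpp'
  obtain ⟨f⟩ := hH p
  obtain ⟨f'⟩ := hH p'
  simpa using Fintype.card_congr ((f'.comp e).comp f.symm).toEquiv

/-- There is a countably infinite family of pairwise non-isomorphic finite graphs, consisting (up to
isomorphism) exactly of the generalized theta graphs `Θ^{(s,p)}` with `s ≥ 2`, `p ≥ 1` and of their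
joins with `K₂`, whose chromatic roots, taken together, are dense in the complex plane. -/
theorem corollary1p3 :
    ∃ (n : ℕ → ℕ) (G : (i : ℕ) → SimpleGraph (Fin (n i))),
      (∀ i j : ℕ, i ≠ j → IsEmpty (G i ≃g G j)) ∧
      (∀ i : ℕ, ∃ s p : ℕ, 2 ≤ s ∧ 1 ≤ p ∧
        (Nonempty (G i ≃g thetaGraph s p) ∨ Nonempty (G i ≃g thetaJoinK2 s p))) ∧
      (∀ s p : ℕ, 2 ≤ s → 1 ≤ p →
        (∃ i : ℕ, Nonempty (G i ≃g thetaGraph s p)) ∧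
        (∃ i : ℕ, Nonempty (G i ≃g thetaJoinK2 s p))) ∧
      Dense (⋃ i : ℕ, chromaticRoots (G i)) := by
  obtain ⟨G, hG, hne, hall⟩ := exists_seq_of_infinite_image_mk finGraphSetoid
    infinite_image_mk_thetaFamily
  have hθ (s p : ℕ) (hs : 2 ≤ s) (hp : 1 ≤ p) : ∃ i, Nonempty ((G i).2 ≃g thetaGraph s p) := by
    obtain ⟨H, ⟨e⟩⟩ := exists_finGraph_iso (thetaGraph s p)
    obtain ⟨i, ⟨f⟩⟩ := hall H ⟨s, p, hs, hp, Or.inl ⟨e⟩⟩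
    exact ⟨i, ⟨e.comp f⟩⟩
  have hJ (s p : ℕ) (hs : 2 ≤ s) (hp : 1 ≤ p) : ∃ i, Nonempty ((G i).2 ≃g thetaJoinK2 s p) := by
    obtain ⟨H, ⟨e⟩⟩ := exists_finGraph_iso (thetaJoinK2 s p)
    obtain ⟨i, ⟨f⟩⟩ := hall H ⟨s, p, hs, hp, Or.inr ⟨e⟩⟩
    exact ⟨i, ⟨e.comp f⟩⟩
  refine ⟨fun i => (G i).1, fun i => (G i).2, fun i j hij => not_nonempty_iff.1 (hne i j hij), hG,
    fun s p hs hp => ⟨hθ s p hs hp, hJ s p hs hp⟩,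
    dense_of_chromaticRoots_theta_subset (fun s p hs hp => ?_) fun s p hs hp => ?_⟩
  · obtain ⟨i, ⟨f⟩⟩ := hθ s p hs hp
    exact chromaticRoots_congr f ▸ Set.subset_iUnion (fun i => chromaticRoots (G i).2) i
  · obtain ⟨i, ⟨f⟩⟩ := hJ s p hs hp
    exact chromaticRoots_congr f ▸ Set.subset_iUnion (fun i => chromaticRoots (G i).2) i
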